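/- A group is called sofic if it embeds into a metric ultraproduct $\prod_{\alpha\in A}(S_{n(\alpha)},d_{\mathrm{hamm}})/\mathcal U$ of finite symmetric groups with the normalized Hamming metric, that is, into the quotient of the full product $\prod_{\alpha\in A}S_{n(\alpha)}$ by the normal subgroup of all $(x_\alpha)$ with $\lim_{\alpha\to\mathcal U}d_{\mathrm{hamm}}(x_\alpha,\mathrm{id})=0$, where $A$ is a set, $\mathcal U$ an ultrafilter on $A$ and $n\colon A\to\mathbb N$. A group is called minimal non-sofic if it is not sofic but all its proper subgroups are sofic. Theorem. Let $G$ be a minimal non-sofic group and let $M$ be a maximal normal subgroup of $G$, i.e. a subgroup that is maximal among the proper normal subgroups of $G$. If $M$ is finitely generated and residually finite, then $M\le Z(G)$. Moreover, in that case $G$ is perfect, so that $1\to M\to G\to G/M\to 1$ is a perfect central extension, and $G/M$ is a finitely generated, non-amenable (as a discrete group), simple group. -/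

import Mathlib

/-- The normalized Hamming distance on the symmetric group `S_n`:
the proportion of points at which two permutations differ. -/
noncomputable def hammDist {n : ℕ} (σ τ : Equiv.Perm (Fin n)) : ℝ :=
  (hammingDist (σ : Fin n → Fin n) (τ : Fin n → Fin n) : ℝ) / n

theorem hammDist_self {n : ℕ} (σ : Equiv.Perm (Fin n)) : hammDist σ σ = 0 := by
  simp [hammDist]

theorem hammDist_nonneg {n : ℕ} (σ τ : Equiv.Perm (Fin n)) : 0 ≤ hammDist σ τ := by
  unfold hammDist; positivity

theorem hammDist_comm {n : ℕ} (σ τ : Equiv.Perm (Fin n)) : hammDist σ τ = hammDist τ σ := by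
  simp [hammDist, hammingDist_comm]

theorem hammDist_triangle {n : ℕ} (σ τ ρ : Equiv.Perm (Fin n)) :
    hammDist σ ρ ≤ hammDist σ τ + hammDist τ ρ := by
  unfold hammDist
  rw [← add_div]
  gcongr
  exact_mod_cast hammingDist_triangle _ _ _

theorem hammDist_mul_left {n : ℕ} (ρ σ τ : Equiv.Perm (Fin n)) :
    hammDist (ρ * σ) (ρ * τ) = hammDist σ τ := by
  simp [hammDist, hammingDist]

theorem hammDist_mul_right {n : ℕ} (ρ σ τ : Equiv.Perm (Fin n)) :
    hammDist (σ * ρ) (τ * ρ) = hammDist σ τ := by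
  unfold hammDist hammingDist
  congr 2
  refine Finset.card_bij (fun i _ => ρ i) ?_ ?_ ?_
  · intro i hi
    simp only [Finset.mem_filter_univ] at hi ⊢
    exact hi
  · intro i _ j _ h; exact ρ.injective h
  · intro j hj
    obtain ⟨i, rfl⟩ := ρ.surjective j
    simp only [Finset.mem_filter_univ] at hj
    exact ⟨i, Finset.mem_filter.2 ⟨Finset.mem_univ _, hj⟩, rfl⟩

/-- The normal subgroup of `∏ α, S_{n α}` of all sequences of permutations whose distance to
the identity tends to `0` along the ultrafilter `U`. -/
def ultraNull {A : Type*} (U : Ultrafilter A) (n : A → ℕ) :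
    Subgroup (∀ α, Equiv.Perm (Fin (n α))) where
  carrier := {x | Filter.Tendsto (fun α => hammDist (x α) 1) (U : Filter A) (nhds 0)}
  one_mem' := by
    refine Filter.Tendsto.congr (fun α => ?_) tendsto_const_nhds
    exact (hammDist_self 1).symm
  mul_mem' := by
    intro x y hx hy
    have h := Filter.Tendsto.add hx hy
    rw [add_zero] at h
    refine squeeze_zero (fun α => hammDist_nonneg _ _) (fun α => ?_) h
    have h1 := hammDist_triangle (x α * y α) (y α) 1
    have h2 := hammDist_mul_right (y α) (x α) 1
    rw [one_mul] at h2
    simp only [Pi.mul_apply]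
    linarith
  inv_mem' := by
    intro x hx
    refine Filter.Tendsto.congr (fun α => ?_) hx
    have h := hammDist_mul_left (x α)⁻¹ (x α) 1
    rw [inv_mul_cancel, mul_one] at h
    rw [← h, hammDist_comm, Pi.inv_apply]

instance ultraNull_normal {A : Type*} (U : Ultrafilter A) (n : A → ℕ) :
    (ultraNull U n).Normal where
  conj_mem := by
    intro x hx g
    refine Filter.Tendsto.congr (fun α => ?_) hx
    have h1 := hammDist_mul_left (g α) (x α) 1
    have h2 := hammDist_mul_right (g α)⁻¹ (g α * x α) (g α * 1)
    rw [mul_one, mul_inv_cancel] at h2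
    rw [mul_one] at h1
    rw [← h1, ← h2]
    rfl

/-- The metric ultraproduct of the symmetric groups `S_{n α}` along `U`, where each `S_{n α}`
carries the normalized Hamming distance. -/
abbrev MetricUltraproduct {A : Type*} (U : Ultrafilter A) (n : A → ℕ) : Type _ :=
  (∀ α, Equiv.Perm (Fin (n α))) ⧸ ultraNull U n

/-- A group is sofic if it is isomorphic to a subgroup of a metric ultraproduct of finite
symmetric groups with the normalized Hamming distance. -/
def IsSofic.{u} (G : Type u) [Group G] : Prop :=
  ∃ (A : Type u) (U : Ultrafilter A) (n : A → ℕ) (φ : G →* MetricUltraproduct U n),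
    Function.Injective φ

/-- A group is minimal non-sofic if it is not sofic but all its proper subgroups are. -/
structure IsMinimalNonSofic (G : Type*) [Group G] : Prop where
  not_sofic : ¬ IsSofic G
  sofic_of_proper : ∀ H : Subgroup G, H ≠ ⊤ → IsSofic H

/-- A maximal normal subgroup: maximal among the proper normal subgroups. -/
def IsMaximalNormal {G : Type*} [Group G] (M : Subgroup G) : Prop :=
  Maximal (fun N : Subgroup G => N.Normal ∧ N ≠ ⊤) M

open scoped Classical Pointwise in
/-- Amenability of a discrete group (Følner): for every finite set `K` and every `ε > 0` there is
a nonempty finite set `F` such that `|gF ∆ F| ≤ ε |F|` for all `g ∈ K`. -/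
def IsAmenableGroup (G : Type*) [Group G] : Prop :=
  ∀ (K : Finset G) (ε : ℝ), 0 < ε → ∃ F : Finset G, F.Nonempty ∧
    ∀ g ∈ K, ((symmDiff (g • F) F).card : ℝ) ≤ ε * (F.card : ℝ)

/-- The extension `1 → M → G → G ⧸ M → 1` given by a normal subgroup `M` of `G`. -/
def quotientExtension {G : Type*} [Group G] (M : Subgroup G) [M.Normal] :
    GroupExtension M G (G ⧸ M) where
  inl := M.subtype
  rightHom := QuotientGroup.mk' M
  inl_injective := M.subtype_injective
  range_inl_eq_ker_rightHom := by simp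
  rightHom_surjective := QuotientGroup.mk'_surjective M

/-- An extension `1 → N → E → Q → 1` is a perfect central extension of `Q` by `N` if `N` is
central in `E` and the group `E` is perfect. -/
structure IsPerfectCentralExtension {N E Q : Type*} [Group N] [Group E] [Group Q]
    (S : GroupExtension N E Q) : Prop where
  central : S.inl.range ≤ Subgroup.center E
  perfect : Group.IsPerfect E

/-!
The three facts that carry the proof are closure properties of soficity. A group all of whose
finitely generated subgroups are sofic is sofic (`HasSoficApproximations.of_closure`), a group with
a sofic subgroup of finite index is sofic (`HasSoficApproximations.of_finiteIndex`), and a group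
that is residually amenable is sofic (`HasSoficApproximations.of_hasFolnerSets`). All three are
proved for a finitary form of soficity, in terms of approximate actions on finite sets, which is
equivalent to embeddability into a metric ultraproduct
(`IsSofic.hasSoficApproximations`, `HasSoficApproximations.isSofic`).

By the first two, a minimal non-sofic group `G` is finitely generated and has no proper subgroup of
finite index. Hence `G` is perfect, as a nontrivial finitely generated abelian group has proper
subgroups of finite index. Moreover `G` acts trivially, by conjugation, on the set of homomorphisms
from `M` to a finite group, because this set is finite when `M` is finitely generated. So the
commutators of elements of `G` with elements of `M` die in every finite quotient of `M`, and
residual finiteness puts `M` in the center.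

Once `M` is central, its subgroups of finite index are normal in `G`, and they have trivial
intersection. If `G ⧸ M` were amenable, then `G` would be residually an extension of an amenable
group by a finite group, hence residually amenable and sofic, a contradiction.
-/

open Filter Topology

/-! ### Agreement of permutations -/

/-- The number of points at which two permutations agree. -/
noncomputable def agreement {X : Type*} (σ τ : Equiv.Perm X) : ℕ :=
  Nat.card {x // σ x = τ x}

theorem agreement_self {X : Type*} (σ : Equiv.Perm X) : agreement σ σ = Nat.card X :=
  Nat.card_congr (Equiv.subtypeUnivEquiv fun _ => rfl)

theorem agreement_eq_hammDist {n : ℕ} (σ τ : Equiv.Perm (Fin n)) :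
    (agreement σ τ : ℝ) = (1 - hammDist σ τ) * n := by
  rcases Nat.eq_zero_or_pos n with rfl | hn
  · simp [agreement]
  have hn' : (n : ℝ) ≠ 0 := by positivity
  have h := Finset.card_filter_add_card_filter_not (s := (Finset.univ : Finset (Fin n)))
    (fun i => σ i = τ i)
  rw [Finset.card_univ, Fintype.card_fin] at h
  have h' : (agreement σ τ : ℝ) + hammingDist (σ : Fin n → Fin n) (τ : Fin n → Fin n) = n := by
    rw [agreement, Nat.card_eq_fintype_card, Fintype.card_subtype]
    exact_mod_cast h
  rw [hammDist, sub_mul, div_mul_cancel₀ _ hn', ← h']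
  ring

theorem agreement_permCongr {X Y : Type*} (e : X ≃ Y) (σ τ : Equiv.Perm X) :
    agreement (e.permCongr σ) (e.permCongr τ) = agreement σ τ :=
  Nat.card_congr (e.symm.subtypeEquiv fun y => by simp [Equiv.permCongr_apply])

theorem agreement_piCongrRight {X : Type*} (k : ℕ) (σ τ : Equiv.Perm X) :
    agreement (Equiv.piCongrRight fun _ : Fin k => σ) (Equiv.piCongrRight fun _ : Fin k => τ) =
      agreement σ τ ^ k := by
  have e : {v : Fin k → X // (Equiv.piCongrRight fun _ : Fin k => σ) v =
      (Equiv.piCongrRight fun _ : Fin k => τ) v} ≃ (Fin k → {x // σ x = τ x}) :=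
    (Equiv.subtypeEquivRight fun v => by simp [funext_iff]).trans Equiv.subtypePiEquivPi
  rw [agreement, Nat.card_congr e, Nat.card_fun, Nat.card_fin, agreement]

theorem agreement_prodShear {Y X : Type*} [Fintype Y] [Finite X] (a b : Equiv.Perm Y)
    (e f : Y → Equiv.Perm X) :
    agreement (Equiv.prodShear a e) (Equiv.prodShear b f) =
      ∑ y, Nat.card {x // a y = b y ∧ e y x = f y x} := by
  rw [← Nat.card_sigma, ← Nat.card_congr
    (Equiv.subtypeProdEquivSigmaSubtype fun y x => a y = b y ∧ e y x = f y x)]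
  exact Nat.card_congr (Equiv.subtypeEquivRight fun p => by simp [Equiv.prodShear, Prod.ext_iff])

/-! ### The finitary form of soficity -/

/-- A map `θ` from a group to the permutations of a finite set is an `(S, ε)`-approximate action
if it is multiplicative on `S` up to a proportion `ε` of the points, and every nontrivial element
of `S` fixes at most half of the points. The bound one half carries no meaning beyond being
a constant smaller than one, uniform in `S` and `ε`. -/
def IsApproxAction {G : Type*} [Group G] {X : Type*} (S : Finset G) (ε : ℝ)
    (θ : G → Equiv.Perm X) : Prop :=
  (∀ g ∈ S, ∀ h ∈ S, (1 - ε) * Nat.card X ≤ agreement (θ (g * h)) (θ g * θ h)) ∧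
    ∀ g ∈ S, g ≠ 1 → 2 * agreement (θ g) 1 ≤ Nat.card X

/-- The finitary form of soficity: approximate actions on nonempty finite sets exist for
every finite subset and every tolerance. -/
def HasSoficApproximations (G : Type*) [Group G] : Prop :=
  ∀ (S : Finset G) (ε : ℝ), 0 < ε →
    ∃ n : ℕ, 0 < n ∧ ∃ θ : G → Equiv.Perm (Fin n), IsApproxAction S ε θ

theorem IsApproxAction.exists_fin {G : Type*} [Group G] {X : Type*} [Finite X] [Nonempty X]
    {S : Finset G} {ε : ℝ} {θ : G → Equiv.Perm X} (h : IsApproxAction S ε θ) :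
    ∃ n : ℕ, 0 < n ∧ ∃ θ : G → Equiv.Perm (Fin n), IsApproxAction S ε θ := by
  let e := Finite.equivFin X
  refine ⟨Nat.card X, Nat.card_pos, fun g => e.permCongr (θ g), fun g hg k hk => ?_,
    fun g hg hg1 => ?_⟩
  · have : e.permCongr (θ g) * e.permCongr (θ k) = e.permCongr (θ g * θ k) := by ext; simp
    rw [this, agreement_permCongr, Nat.card_fin]
    exact h.1 g hg k hk
  · have : (1 : Equiv.Perm (Fin (Nat.card X))) = e.permCongr 1 := by ext; simp
    rw [this, agreement_permCongr, Nat.card_fin]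
    exact h.2 g hg hg1

theorem MetricUltraproduct.mk_eq_mk_iff {A : Type*} {U : Ultrafilter A} {n : A → ℕ}
    (x y : ∀ α, Equiv.Perm (Fin (n α))) :
    (QuotientGroup.mk x : MetricUltraproduct U n) = QuotientGroup.mk y ↔
      Tendsto (fun α => hammDist (x α) (y α)) U (𝓝 0) := by
  rw [QuotientGroup.eq]
  refine tendsto_congr fun α => ?_
  have h := hammDist_mul_left (x α) ((x α)⁻¹ * y α) 1
  rw [mul_inv_cancel_left, mul_one, hammDist_comm (y α)] at h
  rw [h]
  rfl

/-- Amplification: passing to the diagonal action on `k`-tuples raises the proportion of agreement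
to the `k`-th power, so a proportion of fixed points bounded away from one becomes at most
one half, while the failure of multiplicativity grows at most by the factor `k`. -/
theorem IsSofic.hasSoficApproximations {G : Type*} [Group G] (hG : IsSofic G) :
    HasSoficApproximations G := by
  obtain ⟨A, U, n, φ, hφ⟩ := hG
  intro S ε hε
  -- The trivial case is apart because then the chosen symmetric group could be `S_0`.
  by_cases hS : ∀ g ∈ S, g = 1
  · refine ⟨1, one_pos, fun _ => 1, fun g _ h _ => ?_, fun g hg hg1 => absurd (hS g hg) hg1⟩
    rw [one_mul, agreement_self]
    simp [hε.le]
  push Not at hS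
  obtain ⟨s, hs, hs1⟩ := hS
  choose x hx using fun g => QuotientGroup.mk_surjective (φ g)
  have hmul (g h : G) : Tendsto (fun α => hammDist (x (g * h) α) (x g α * x h α)) U (𝓝 0) := by
    refine (MetricUltraproduct.mk_eq_mk_iff (x (g * h)) (x g * x h)).1 ?_
    rw [QuotientGroup.mk_mul, hx, hx, hx, map_mul]
  have hne (g : G) (hg : g ≠ 1) : ∃ c > 0, ∀ᶠ α in U, c ≤ hammDist (x g α) 1 := by
    by_contra! hcon
    refine hg (hφ ?_)
    rw [map_one, ← hx g]
    refine (MetricUltraproduct.mk_eq_mk_iff (x g) 1).2 (tendsto_order.2 ⟨fun a ha =>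
      Eventually.of_forall fun α => ha.trans_le (hammDist_nonneg _ _), fun a ha => ?_⟩)
    exact hcon a ha
  have hne' : ∀ᶠ c in 𝓝[>] (0 : ℝ), ∀ g ∈ S, g ≠ 1 → ∀ᶠ α in U, c ≤ hammDist (x g α) 1 := by
    refine (Filter.eventually_all_finset S).2 fun g _ => ?_
    by_cases hg : g = 1
    · simp [hg]
    obtain ⟨c, hc, hc'⟩ := hne g hg
    filter_upwards [Ioo_mem_nhdsGT hc] with d hd _
    exact hc'.mono fun α hα => hd.2.le.trans hα
  obtain ⟨c, hc', hc0, hc1⟩ := (hne'.and (Ioo_mem_nhdsGT one_pos)).exists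
  obtain ⟨k, hk⟩ := exists_pow_lt_of_lt_one (show (0 : ℝ) < 1 / 2 by norm_num)
    (show 1 - c < 1 by linarith)
  obtain ⟨δ, hδ0, hδ1, hδ⟩ : ∃ δ : ℝ, 0 < δ ∧ δ ≤ 1 ∧ k * δ ≤ ε := by
    refine ⟨min 1 (ε / (k + 1)), by positivity, min_le_left _ _, ?_⟩
    calc k * min 1 (ε / (k + 1)) ≤ (k + 1) * (ε / (k + 1)) := by
          gcongr
          · linarith
          · exact min_le_right _ _
      _ = ε := by field_simp
  have hev : ∀ᶠ α in U, (∀ g ∈ S, ∀ h ∈ S, hammDist (x (g * h) α) (x g α * x h α) < δ) ∧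
      ∀ g ∈ S, g ≠ 1 → c ≤ hammDist (x g α) 1 := by
    refine Eventually.and ?_ ?_
    · exact (Filter.eventually_all_finset S).2 fun g _ => (Filter.eventually_all_finset S).2
        fun h _ => (hmul g h).eventually_lt_const hδ0
    · refine (Filter.eventually_all_finset S).2 fun g hg => ?_
      by_cases hg1 : g = 1
      · simp [hg1]
      · exact (hc' g hg hg1).mono fun α hα _ => hα
  obtain ⟨α, hα, hα'⟩ := hev.exists
  have hn : 0 < n α := by
    rcases Nat.eq_zero_or_pos (n α) with h0 | h0
    · have h1 := hα' s hs hs1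
      simp only [hammDist, h0, Nat.cast_zero, div_zero] at h1
      linarith
    · exact h0
  have : Nonempty (Fin (n α)) := ⟨⟨0, hn⟩⟩
  have key : IsApproxAction S ε
      (fun g => Equiv.piCongrRight fun _ : Fin k => x g α) := by
    have hcard : (Nat.card (Fin k → Fin (n α)) : ℝ) = (n α : ℝ) ^ k := by simp
    refine ⟨fun g hg h hh => ?_, fun g hg hg1 => ?_⟩
    · have h1 : (Equiv.piCongrRight fun _ : Fin k => x g α) *
          (Equiv.piCongrRight fun _ : Fin k => x h α) =
          Equiv.piCongrRight fun _ : Fin k => x g α * x h α := rfl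
      rw [h1, agreement_piCongrRight, hcard, Nat.cast_pow, agreement_eq_hammDist, mul_pow]
      gcongr
      have h2 := hα g hg h hh
      calc 1 - ε ≤ 1 + k * (-δ) := by linarith
        _ ≤ (1 + -δ) ^ k := one_add_mul_le_pow (by linarith) k
        _ ≤ _ := pow_le_pow_left₀ (by linarith) (by linarith) k
    · have h1 : (1 : Equiv.Perm (Fin k → Fin (n α))) =
          Equiv.piCongrRight fun _ : Fin k => (1 : Equiv.Perm (Fin (n α))) := rfl
      rw [h1, agreement_piCongrRight, ← @Nat.cast_le ℝ, hcard]
      push_cast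
      rw [agreement_eq_hammDist, mul_pow, ← mul_assoc]
      have h2 := hα' g hg hg1
      have h3 : 0 ≤ 1 - hammDist (x g α) 1 := by
        have := agreement_eq_hammDist (x g α) 1
        have hn' : (0 : ℝ) < n α := by exact_mod_cast hn
        by_contra! hneg
        have h4 := mul_neg_of_neg_of_pos hneg hn'
        have h5 : (0 : ℝ) ≤ agreement (x g α) 1 := Nat.cast_nonneg _
        linarith
      have h4 : (1 - hammDist (x g α) 1) ^ k ≤ (1 - c) ^ k :=
        pow_le_pow_left₀ h3 (by linarith) k
      have h5 : (0 : ℝ) ≤ (n α : ℝ) ^ k := by positivity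
      nlinarith
  exact key.exists_fin

theorem HasSoficApproximations.isSofic {G : Type*} [Group G] (hG : HasSoficApproximations G) :
    IsSofic G := by
  classical
  choose n hn θ hθ using fun p : Finset G × ℕ =>
    hG p.1 (1 / ((p.2 : ℝ) + 1)) Nat.one_div_pos_of_nat
  let U : Ultrafilter (Finset G × ℕ) := Ultrafilter.of atTop
  have hU : (U : Filter (Finset G × ℕ)) ≤ atTop := Ultrafilter.of_le _
  have hmem (g : G) : ∀ᶠ p in (U : Filter (Finset G × ℕ)), g ∈ p.1 :=
    hU ((eventually_ge_atTop (({g} : Finset G), 0)).mono fun p hp =>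
      hp.1 (Finset.mem_singleton_self g))
  have hlim : Tendsto (fun p : Finset G × ℕ => 1 / ((p.2 : ℝ) + 1)) U (𝓝 0) := by
    have h := tendsto_one_div_add_atTop_nhds_zero_nat (𝕜 := ℝ)
    have h' : Tendsto (Prod.snd : Finset G × ℕ → ℕ) atTop atTop := by
      rw [← prod_atTop_atTop_eq]; exact tendsto_snd
    exact (h.comp h').mono_left hU
  refine ⟨Finset G × ℕ, U, n, MonoidHom.mk' (fun g => QuotientGroup.mk fun p => θ p g)
    fun g h => ?_, (injective_iff_map_eq_one _).2 fun g hg => ?_⟩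
  · refine (MetricUltraproduct.mk_eq_mk_iff _ (fun p => θ p g * θ p h)).2
      (squeeze_zero' (Eventually.of_forall fun _ => hammDist_nonneg _ _) ?_ hlim)
    filter_upwards [hmem g, hmem h] with p hpg hph
    have h1 := (hθ p).1 g hpg h hph
    have hn' : (0 : ℝ) < n p := by exact_mod_cast hn p
    rw [agreement_eq_hammDist, Nat.card_fin] at h1
    linarith [le_of_mul_le_mul_right h1 hn']
  · by_contra hg1
    have h1 := (MetricUltraproduct.mk_eq_mk_iff (U := U) (fun p => θ p g) 1).1 hg
    obtain ⟨p, hp, hp'⟩ := ((hmem g).and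
      (h1.eventually_lt_const (show (0 : ℝ) < 1 / 2 by norm_num))).exists
    have h2 := (hθ p).2 g hp hg1
    have hn' : (0 : ℝ) < n p := by exact_mod_cast hn p
    rw [← @Nat.cast_le ℝ, Nat.card_fin] at h2
    push_cast at h2
    rw [agreement_eq_hammDist] at h2
    simp only [Pi.one_apply] at hp'
    nlinarith

/-! ### Finitely generated subgroups and subgroups of finite index -/

theorem HasSoficApproximations.of_closure {G : Type*} [Group G]
    (h : ∀ S : Finset G, HasSoficApproximations (Subgroup.closure (S : Set G))) :
    HasSoficApproximations G := by
  classical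
  intro S ε hε
  set H := Subgroup.closure (S : Set G)
  have hSH (g : G) (hg : g ∈ S) : g ∈ H := Subgroup.subset_closure hg
  obtain ⟨n, hn, θ, hθ⟩ := h S (S.preimage Subtype.val Subtype.val_injective.injOn) ε hε
  refine ⟨n, hn, fun g => if hg : g ∈ H then θ ⟨g, hg⟩ else 1, fun g hg k hk => ?_,
    fun g hg hg1 => ?_⟩
  · beta_reduce
    rw [dif_pos (hSH g hg), dif_pos (hSH k hk), dif_pos (H.mul_mem (hSH g hg) (hSH k hk))]
    exact hθ.1 ⟨g, hSH g hg⟩ (by simpa using hg) ⟨k, hSH k hk⟩ (by simpa using hk)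
  · beta_reduce
    rw [dif_pos (hSH g hg)]
    exact hθ.2 ⟨g, hSH g hg⟩ (by simpa using hg) (by simpa [Subtype.ext_iff] using hg1)

/-- The cocycle `G × G ⧸ H → H` of the chosen section `Quotient.out` of `G → G ⧸ H`. -/
noncomputable def cosetCocycle {G : Type*} [Group G] (H : Subgroup G) (g : G) (q : G ⧸ H) : H :=
  ⟨(g • q).out⁻¹ * (g * q.out), by
    rw [← QuotientGroup.eq, QuotientGroup.out_eq', ← smul_eq_mul, MulAction.Quotient.coe_smul_out]⟩

theorem cosetCocycle_mul {G : Type*} [Group G] (H : Subgroup G) (g h : G) (q : G ⧸ H) :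
    cosetCocycle H (g * h) q = cosetCocycle H g (h • q) * cosetCocycle H h q := by
  ext
  simp [cosetCocycle, mul_smul, mul_assoc]

theorem cosetCocycle_ne_one {G : Type*} [Group G] {H : Subgroup G} {g : G} {q : G ⧸ H}
    (hq : g • q = q) (hg : g ≠ 1) : cosetCocycle H g q ≠ 1 := by
  intro h
  have h' : (g • q).out⁻¹ * (g * q.out) = 1 := congrArg Subtype.val h
  rw [hq, inv_mul_eq_one] at h'
  exact hg (by simpa using h'.symm)

/-- Approximate actions of a finite-index subgroup are induced to the whole group. -/
theorem HasSoficApproximations.of_finiteIndex {G : Type*} [Group G] (H : Subgroup G)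
    [H.FiniteIndex] (hH : HasSoficApproximations H) : HasSoficApproximations G := by
  classical
  intro S ε hε
  have : Fintype (G ⧸ H) := Fintype.ofFinite _
  obtain ⟨n, hn, θ, hθ⟩ := hH
    ((S ×ˢ (Finset.univ : Finset (G ⧸ H))).image fun p => cosetCocycle H p.1 p.2) ε hε
  have hmem (g : G) (hg : g ∈ S) (q : G ⧸ H) : cosetCocycle H g q ∈
      (S ×ˢ (Finset.univ : Finset (G ⧸ H))).image fun p => cosetCocycle H p.1 p.2 :=
    Finset.mem_image.2 ⟨(g, q), by simpa using hg, rfl⟩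
  have : Nonempty (Fin n) := ⟨⟨0, hn⟩⟩
  have key : IsApproxAction S ε (fun g => Equiv.prodShear (MulAction.toPerm g : Equiv.Perm (G ⧸ H))
      fun q => θ (cosetCocycle H g q)) := by
    refine ⟨fun g hg h hh => ?_, fun g hg hg1 => ?_⟩
    · have h1 : (Equiv.prodShear (MulAction.toPerm g : Equiv.Perm (G ⧸ H))
          fun q => θ (cosetCocycle H g q)) * (Equiv.prodShear
          (MulAction.toPerm h : Equiv.Perm (G ⧸ H)) fun q => θ (cosetCocycle H h q)) =
          Equiv.prodShear (MulAction.toPerm (g * h) : Equiv.Perm (G ⧸ H))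
          fun q => θ (cosetCocycle H g (h • q)) * θ (cosetCocycle H h q) := by
        ext p <;> simp [Equiv.prodShear, mul_smul]
      rw [h1, agreement_prodShear, Nat.card_prod, Nat.card_eq_fintype_card (α := G ⧸ H),
        ← Finset.card_univ]
      push_cast
      rw [mul_left_comm, ← nsmul_eq_mul, ← Finset.sum_const]
      refine Finset.sum_le_sum fun q _ => ?_
      simp only [true_and, cosetCocycle_mul]
      exact hθ.1 _ (hmem g hg _) _ (hmem h hh _)
    · have h1 : (1 : Equiv.Perm ((G ⧸ H) × Fin n)) = Equiv.prodShear 1 fun _ => 1 := rfl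
      rw [h1, agreement_prodShear, Nat.card_prod, Nat.card_eq_fintype_card (α := G ⧸ H),
        ← Finset.card_univ, Finset.mul_sum, ← smul_eq_mul, ← Finset.sum_const]
      refine Finset.sum_le_sum fun q _ => ?_
      by_cases hq : g • q = q
      · simpa [hq, agreement] using hθ.2 _ (hmem g hg q) (cosetCocycle_ne_one hq hg1)
      · simp [hq]
  exact key.exists_fin

/-! ### Amenability -/

/-- A Følner condition with one-sided boundaries: every finite set `K` has, for every `δ > 0`,
a nonempty finite set `F` that each `g ∈ K` moves out of itself in at most `δ |F|` points. -/
def HasFolnerSets (G : Type*) [Group G] : Prop :=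
  ∀ (K : Finset G) (δ : ℝ), 0 < δ → ∃ F : Finset G, F.Nonempty ∧
    ∀ g ∈ K, (Nat.card {x : F // g * x ∉ F} : ℝ) ≤ δ * F.card

open scoped Pointwise in
theorem IsAmenableGroup.hasFolnerSets {G : Type*} [Group G] (hG : IsAmenableGroup G) :
    HasFolnerSets G := by
  classical
  intro K δ hδ
  obtain ⟨F, hF, h⟩ := hG K δ hδ
  refine ⟨F, hF, fun g hg => le_trans ?_ (h g hg)⟩
  rw [Nat.cast_le, ← Nat.card_eq_finsetCard (symmDiff (g • F) F)]
  refine Nat.card_le_card_of_injective (fun x : {x : F // g * x ∉ F} =>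
    (⟨g * x, ?_⟩ : (symmDiff (g • F) F : Finset G))) fun x y hxy => ?_
  · exact Finset.mem_symmDiff.2 (Or.inl ⟨Finset.smul_mem_smul_finset x.1.2, x.2⟩)
  · exact Subtype.ext (Subtype.ext (mul_left_cancel (congrArg Subtype.val hxy)))

/-- An extension of a group with Følner sets by a finite kernel has Følner sets, namely
the preimages. -/
theorem HasFolnerSets.of_finite_ker {G Q : Type*} [Group G] [Group Q] (hQ : HasFolnerSets Q)
    (f : G →* Q) (hf : Function.Surjective f) [Finite f.ker] : HasFolnerSets G := by
  classical
  intro K δ hδ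
  obtain ⟨F, hF, h⟩ := hQ (K.image f) δ hδ
  have hfib (P : Q → Prop) : Nat.card {x : G // P (f x)} = Nat.card {y : Q // P y} *
      Nat.card f.ker := by
    let e : G ≃ Q × f.ker := (Equiv.sigmaFiberEquiv f).symm.trans
      ((Equiv.sigmaCongrRight fun y => f.fiberEquivKerOfSurjective hf y).trans
        (Equiv.sigmaEquivProd Q f.ker))
    rw [← Nat.card_prod]
    exact Nat.card_congr ((e.subtypeEquiv (q := fun p => P p.1) fun _ => Iff.rfl).trans
      Equiv.prodSubtypeFstEquivSubtypeProd)
  have hfin : {x : G | f x ∈ F}.Finite := by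
    refine Set.finite_coe_iff.1 (Nat.finite_of_card_ne_zero ?_)
    have h1 := hfib (· ∈ F)
    rw [Nat.card_eq_finsetCard] at h1
    exact h1.trans_ne (mul_ne_zero hF.card_pos.ne' Nat.card_pos.ne')
  have hmem (x : G) : x ∈ hfin.toFinset ↔ f x ∈ F := by simp
  refine ⟨hfin.toFinset, ?_, fun g hg => ?_⟩
  · obtain ⟨y, hy⟩ := hF
    obtain ⟨x, rfl⟩ := hf y
    exact ⟨x, (hmem x).2 hy⟩
  have h1 : Nat.card {x : hfin.toFinset // g * x ∉ hfin.toFinset} =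
      Nat.card {y : F // f g * y ∉ F} * Nat.card f.ker := by
    rw [Nat.card_congr (Equiv.subtypeSubtypeEquivSubtypeInter (· ∈ F) (fun y => f g * y ∉ F)),
      ← hfib, Nat.card_congr (Equiv.subtypeSubtypeEquivSubtypeInter (· ∈ hfin.toFinset)
        (fun x => g * x ∉ hfin.toFinset))]
    exact Nat.card_congr (Equiv.subtypeEquivRight fun x => by simp)
  have h2 : hfin.toFinset.card = F.card * Nat.card f.ker := by
    rw [← Nat.card_eq_finsetCard, ← Nat.card_eq_finsetCard F, ← hfib]
    exact Nat.card_congr (Equiv.subtypeEquivRight hmem)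
  rw [h1, h2]
  push_cast
  rw [← mul_assoc]
  gcongr
  exact h _ (Finset.mem_image_of_mem f hg)

theorem Nat.card_subtype_or_le {X : Type*} [Finite X] (P Q : X → Prop) :
    Nat.card {x // P x ∨ Q x} ≤ Nat.card {x // P x} + Nat.card {x // Q x} := by
  rw [← Nat.card_sum]
  refine Nat.card_le_card_of_surjective
    (Sum.elim (fun x => ⟨x, Or.inl x.2⟩) fun x => ⟨x, Or.inr x.2⟩) ?_
  rintro ⟨x, hx | hx⟩
  · exact ⟨Sum.inl ⟨x, hx⟩, rfl⟩
  · exact ⟨Sum.inr ⟨x, hx⟩, rfl⟩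

/-- The partially defined left multiplication by `g` on a finite set extends to a permutation. -/
theorem exists_perm_extending_mul_left {G : Type*} [Group G] (F : Finset G) (g : G) :
    ∃ σ : Equiv.Perm F, ∀ x : F, g * x ∈ F → (σ x : G) = g * x := by
  classical
  obtain ⟨σ, hσ⟩ := Set.MapsTo.exists_equiv_extend_of_card_eq (α := F) (t := F)
    (s := {x : F | g * x ∈ F}) (f := fun x => g * x) (by simp) (fun x hx => hx)
    (fun x _ y _ hxy => Subtype.ext (mul_left_cancel hxy))
  exact ⟨σ, hσ⟩

/-- Left multiplication on a Følner set, completed arbitrarily to permutations, gives approximate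
actions. Homomorphisms to groups with Følner sets may depend on the finite set of elements to be
separated from the identity, so this covers residually amenable groups. -/
theorem HasSoficApproximations.of_hasFolnerSets.{u, v} {G : Type u} [Group G]
    (h : ∀ S : Finset G, ∃ (Q : Type v) (_ : Group Q) (f : G →* Q), HasFolnerSets Q ∧
      ∀ g ∈ S, g ≠ 1 → f g ≠ 1) : HasSoficApproximations G := by
  classical
  intro S ε hε
  obtain ⟨Q, _, f, hQ, hf⟩ := h S
  obtain ⟨F, hF, hK⟩ := hQ (S.image f ∪ (S ×ˢ S).image fun p => f p.1 * f p.2)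
    (min (ε / 2) (1 / 2)) (by positivity)
  choose σ hσ using exists_perm_extending_mul_left F
  have : Nonempty F := hF.to_subtype
  have hcard : Nat.card F = F.card := Nat.card_eq_finsetCard F
  have hb (q : Q) (hq : q ∈ S.image f ∪ (S ×ˢ S).image fun p => f p.1 * f p.2) :
      (Nat.card {x : F // q * x ∉ F} : ℝ) ≤ ε / 2 * F.card ∧
        (Nat.card {x : F // q * x ∉ F} : ℝ) ≤ 1 / 2 * F.card := by
    refine ⟨(hK q hq).trans ?_, (hK q hq).trans ?_⟩ <;> gcongr
    · exact min_le_left _ _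
    · exact min_le_right _ _
  have key : IsApproxAction S ε fun g => σ (f g) := by
    refine ⟨fun g hg k hk => ?_, fun g hg hg1 => ?_⟩
    · have h1 : Nat.card F ≤ agreement (σ (f (g * k))) (σ (f g) * σ (f k)) +
          (Nat.card {x : F // f k * x ∉ F} + Nat.card {x : F // f g * f k * x ∉ F}) := by
        refine le_trans ?_ (add_le_add_right (Nat.card_subtype_or_le _ _) _)
        refine le_trans ?_ (Nat.card_subtype_or_le _ _)
        refine (Nat.card_congr (Equiv.subtypeUnivEquiv fun x => ?_).symm).le
        by_cases hx1 : f k * x ∈ F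
        · by_cases hx2 : f g * f k * x ∈ F
          · left
            have hx3 : f g * (σ (f k) x : Q) = f g * f k * x := by rw [hσ _ _ hx1, mul_assoc]
            ext
            rw [Equiv.Perm.mul_apply, hσ (f g) _ (by rwa [hx3]), hx3, map_mul, hσ _ _ hx2]
          · exact Or.inr (Or.inr hx2)
        · exact Or.inr (Or.inl hx1)
      have h2 := (hb (f k) (Finset.mem_union_left _ (Finset.mem_image_of_mem f hk))).1
      have h3 := (hb (f g * f k) (Finset.mem_union_right _
        (Finset.mem_image.2 ⟨(g, k), Finset.mk_mem_product hg hk, rfl⟩))).1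
      rw [← @Nat.cast_le ℝ] at h1
      push_cast at h1
      rw [hcard] at h1 ⊢
      linarith
    · have h1 : agreement (σ (f g)) 1 ≤ Nat.card {x : F // f g * x ∉ F} := by
        refine Nat.card_le_card_of_injective (fun x => ⟨x.1, fun hx => hf g hg hg1 ?_⟩)
          fun x y hxy => Subtype.ext (congrArg (fun z => z.1) hxy)
        have h2 := hσ _ _ hx
        rw [x.2] at h2
        simpa using h2
      have h2 := (hb (f g) (Finset.mem_union_left _ (Finset.mem_image_of_mem f hg))).2
      rw [← @Nat.cast_le ℝ] at h1 ⊢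
      push_cast
      rw [hcard]
      linarith
  exact key.exists_fin

/-! ### Groups without proper subgroups of finite index -/

/-- Since `A / 2A` is finite, `A = 2A`. By Nakayama's lemma an odd integer then annihilates `A`,
so `A` is finite and its trivial subgroup has finite index. -/
theorem AddCommGroup.subsingleton_of_forall_finiteIndex {A : Type*} [AddCommGroup A]
    [hA : AddGroup.FG A] (h : ∀ H : AddSubgroup A, H.FiniteIndex → H = ⊤) : Subsingleton A := by
  have : Module.Finite ℤ A := Module.Finite.iff_addGroup_fg.2 hA
  let D : AddSubgroup A := (zsmulAddGroupHom (α := A) 2).range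
  have hD : D = ⊤ := by
    refine h D ?_
    have hfin : Finite (A ⧸ D) := by
      refine AddCommGroup.finite_of_fg_isAddTorsion _ fun q => ?_
      induction q using QuotientAddGroup.induction_on with
      | H a =>
        refine isOfFinAddOrder_iff_nsmul_eq_zero.2 ⟨2, two_pos, ?_⟩
        rw [← QuotientAddGroup.mk_nsmul, QuotientAddGroup.eq_zero_iff]
        exact ⟨a, by simp [two_zsmul, two_nsmul]⟩
    exact AddSubgroup.finiteIndex_of_finite_quotient
  obtain ⟨r, hr, hrA⟩ := Submodule.exists_sub_one_mem_and_smul_eq_zero_of_fg_of_le_smul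
    (Ideal.span {(2 : ℤ)}) (⊤ : Submodule ℤ A) Module.Finite.fg_top (fun a _ => by
      obtain ⟨b, hb⟩ : a ∈ D := hD ▸ AddSubgroup.mem_top a
      rw [← hb]
      exact Submodule.smul_mem_smul (Ideal.mem_span_singleton_self _) Submodule.mem_top)
  have hr0 : r ≠ 0 := by
    rw [Ideal.mem_span_singleton] at hr
    omega
  have : Finite A := AddCommGroup.finite_of_fg_isAddTorsion _ fun a =>
    isOfFinAddOrder_iff_zsmul_eq_zero.2 ⟨r, hr0, hrA a Submodule.mem_top⟩
  have hbot : (⊥ : AddSubgroup A) = ⊤ := h ⊥ inferInstance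
  exact AddSubgroup.subsingleton_iff.1 (subsingleton_of_bot_eq_top hbot)

theorem finite_monoidHom_of_fg {M Q : Type*} [Group M] [Group Q] [Finite Q] (hM : Group.FG M) :
    Finite (M →* Q) := by
  obtain ⟨S, hS⟩ := (Group.fg_def (G := M)).1 hM
  refine Finite.of_injective (fun (f : M →* Q) (s : S) => f s) fun f g hfg => ?_
  exact MonoidHom.eq_of_eqOn_dense hS fun s hs => congrFun hfg ⟨s, hs⟩

theorem Group.isPerfect_of_forall_finiteIndex {G : Type*} [Group G] [Group.FG G]
    (h : ∀ H : Subgroup G, H.FiniteIndex → H = ⊤) : Group.IsPerfect G := by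
  have : Group.FG (Abelianization G) := QuotientGroup.fg (commutator G)
  have : Subsingleton (Additive (Abelianization G)) := by
    refine AddCommGroup.subsingleton_of_forall_finiteIndex fun H hH => ?_
    let K : Subgroup (Abelianization G) := AddSubgroup.toSubgroup' H
    have hK : K.FiniteIndex := ⟨hH.index_ne_zero⟩
    have h1 := h (K.comap Abelianization.of) ⟨by
      rw [Subgroup.index_comap_of_surjective K (f := Abelianization.of)
        (QuotientGroup.mk'_surjective (commutator G))]
      exact hK.index_ne_zero⟩
    rw [eq_top_iff]
    rintro a -
    obtain ⟨g, hg⟩ := QuotientGroup.mk_surjective (s := commutator G) a.toMul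
    have h2 : g ∈ K.comap Abelianization.of := h1 ▸ Subgroup.mem_top g
    rw [Subgroup.mem_comap] at h2
    change _ = _ at hg
    exact (congrArg (· ∈ K) hg).mp h2
  refine ⟨QuotientGroup.subgroup_eq_top_of_subsingleton _ this⟩

/-- The group acts by conjugation on the finite set of homomorphisms from `M` to a finite
quotient of `M`; without proper subgroups of finite index, it acts trivially. So every commutator
of an element of `M` dies in every finite quotient of `M`. -/
theorem Subgroup.le_center_of_forall_finiteIndex {G : Type*} [Group G]
    (h : ∀ H : Subgroup G, H.FiniteIndex → H = ⊤) (M : Subgroup G) [M.Normal]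
    (hfg : Group.FG M) (hrf : Group.ResiduallyFinite M) : M ≤ Subgroup.center G := by
  have hconj (g : G) (m : M) : MulAut.conjNormal g m = m := by
    rw [← mul_inv_eq_one]
    refine Group.eq_one_iff_forall_finiteIndexNormalSubroup _ fun N => ?_
    have : Finite (M →* M ⧸ N.toSubgroup) := finite_monoidHom_of_fg hfg
    let ρ : G →* Equiv.Perm (M →* M ⧸ N.toSubgroup) := MonoidHom.toHomPerm
      { toFun := fun g π => π.comp (MulAut.conjNormal g⁻¹ : MulAut M).toMonoidHom
        map_one' := funext fun π => MonoidHom.ext fun m => by simp; rfl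
        map_mul' := fun a b => funext fun π => MonoidHom.ext fun m => by simp; rfl }
    have hρ : g⁻¹ ∈ ρ.ker := h ρ.ker inferInstance ▸ Subgroup.mem_top _
    have h1 : ρ g⁻¹ (QuotientGroup.mk' N.toSubgroup) = QuotientGroup.mk' N.toSubgroup := by
      rw [MonoidHom.mem_ker.1 hρ]; rfl
    have h2 := DFunLike.congr_fun h1 m
    have h3 : QuotientGroup.mk' N.toSubgroup (MulAut.conjNormal g⁻¹⁻¹ m) =
      QuotientGroup.mk' N.toSubgroup m := h2
    rw [inv_inv] at h3
    have h4 : MulAut.conjNormal g m * m⁻¹ ∈ (QuotientGroup.mk' N.toSubgroup).ker := by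
      rw [MonoidHom.mem_ker, map_mul, h3, map_inv, mul_inv_cancel]
    rwa [QuotientGroup.ker_mk'] at h4
  intro m hm
  rw [Subgroup.mem_center_iff]
  intro g
  have h1 := congrArg Subtype.val (hconj g ⟨m, hm⟩)
  rw [MulAut.conjNormal_apply] at h1
  exact mul_inv_eq_iff_eq_mul.1 h1

/-! ### Central extensions of amenable groups -/

/-- An extension of an amenable group by a central residually finite group is residually an
extension of an amenable group by a finite group, as finite-index subgroups of the kernel are
normal. -/
theorem HasSoficApproximations.of_le_center {G : Type*} [Group G] (M : Subgroup G) [M.Normal]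
    (hM : M ≤ Subgroup.center G) (hrf : Group.ResiduallyFinite M)
    (ham : IsAmenableGroup (G ⧸ M)) : HasSoficApproximations G := by
  classical
  refine HasSoficApproximations.of_hasFolnerSets fun S => ?_
  have hN (s : G) : ∃ N : Subgroup M, N.FiniteIndex ∧
      (s ≠ 1 → ∀ hs : s ∈ M, (⟨s, hs⟩ : M) ∉ N) := by
    by_cases hs : s ∈ M ∧ s ≠ 1
    · obtain ⟨N, hN⟩ := Group.exists_finiteIndexNormalSubgroup_notMem (⟨s, hs.1⟩ : M)
        (by simpa [Subtype.ext_iff] using hs.2)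
      exact ⟨N.toSubgroup, inferInstance, fun _ _ => hN⟩
    · exact ⟨⊤, inferInstance, fun h1 h2 => absurd ⟨h2, h1⟩ hs⟩
  choose N hNfin hN using hN
  let L : Subgroup M := ⨅ s : S, N s
  have hL : L.FiniteIndex := Subgroup.finiteIndex_iInf fun s => hNfin s
  let K : Subgroup G := L.map M.subtype
  have hKM : K ≤ M := Subgroup.map_subtype_le L
  have hK : K.Normal := ⟨fun k hk g => by
    rwa [Subgroup.mem_center_iff.1 (hM (hKM hk)) g, mul_inv_cancel_right]⟩
  let f : G ⧸ K →* G ⧸ M := QuotientGroup.map K M (MonoidHom.id G) hKM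
  have hf : Function.Surjective f := fun q => by
    obtain ⟨g, rfl⟩ := QuotientGroup.mk_surjective q
    exact ⟨g, rfl⟩
  have hker : Finite f.ker := by
    let ι : M →* G ⧸ K := (QuotientGroup.mk' K).comp M.subtype
    have hι : L ≤ ι.ker := fun m hm => by
      rw [MonoidHom.mem_ker]
      exact (QuotientGroup.eq_one_iff (m : G)).2 ⟨m, hm, rfl⟩
    have : ι.ker.FiniteIndex := Subgroup.finiteIndex_of_le hι
    have : Finite ι.range := Finite.of_equiv _ (QuotientGroup.quotientKerEquivRange ι).toEquiv
    refine Set.Finite.subset (Set.toFinite (ι.range : Set (G ⧸ K))) fun q hq => ?_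
    obtain ⟨g, rfl⟩ := QuotientGroup.mk_surjective q
    exact ⟨⟨g, (QuotientGroup.eq_one_iff g).1 hq⟩, rfl⟩
  refine ⟨G ⧸ K, inferInstance, QuotientGroup.mk' K, ham.hasFolnerSets.of_finite_ker f hf,
    fun s hs hs1 hsK => ?_⟩
  obtain ⟨m, hm, rfl⟩ := (QuotientGroup.eq_one_iff s).1 hsK
  exact hN (m : G) hs1 m.2 (Subgroup.mem_iInf.1 hm ⟨m, hs⟩)

/-! ### Minimal non-sofic groups -/

theorem IsMinimalNonSofic.fg {G : Type*} [Group G] (hG : IsMinimalNonSofic G) : Group.FG G := by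
  by_contra hfg
  refine hG.not_sofic (HasSoficApproximations.of_closure fun S => ?_).isSofic
  exact (hG.sofic_of_proper _ fun hS =>
    hfg ((Group.fg_def).2 ⟨S, hS⟩)).hasSoficApproximations

theorem IsMinimalNonSofic.eq_top_of_finiteIndex {G : Type*} [Group G] (hG : IsMinimalNonSofic G)
    (H : Subgroup G) [H.FiniteIndex] : H = ⊤ := by
  by_contra hH
  exact hG.not_sofic
    (HasSoficApproximations.of_finiteIndex H (hG.sofic_of_proper H hH).hasSoficApproximations).isSofic

theorem IsMaximalNormal.isSimpleGroup_quotient {G : Type*} [Group G] {M : Subgroup G} [M.Normal]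
    (hM : IsMaximalNormal M) : IsSimpleGroup (G ⧸ M) where
  exists_pair_ne := by
    obtain ⟨g, hg⟩ := not_forall.1 fun h => hM.prop.2 ((Subgroup.eq_top_iff' M).2 h)
    exact ⟨g, 1, fun h => hg ((QuotientGroup.eq_one_iff g).1 h)⟩
  eq_bot_or_eq_top_of_normal N hN := by
    have hle : M ≤ N.comap (QuotientGroup.mk' M) := by
      intro m hm
      rw [Subgroup.mem_comap, QuotientGroup.mk'_apply, (QuotientGroup.eq_one_iff m).2 hm]
      exact N.one_mem
    have hsurj := QuotientGroup.mk'_surjective M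
    by_cases htop : N.comap (QuotientGroup.mk' M) = ⊤
    · right
      rw [← Subgroup.map_comap_eq_self_of_surjective hsurj N, htop,
        Subgroup.map_top_of_surjective _ hsurj]
    · left
      have h1 : N.comap (QuotientGroup.mk' M) ≤ M := hM.2 ⟨inferInstance, htop⟩ hle
      rw [← Subgroup.map_comap_eq_self_of_surjective hsurj N, Subgroup.map_eq_bot_iff,
        QuotientGroup.ker_mk']
      exact h1

theorem theorem1p5 {G : Type*} [Group G] (hG : IsMinimalNonSofic G)
    (M : Subgroup G) [M.Normal] (hM : IsMaximalNormal M)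
    (hfg : Group.FG M) (hrf : Group.ResiduallyFinite M) :
    M ≤ Subgroup.center G ∧
      IsPerfectCentralExtension (quotientExtension M) ∧
      Group.FG (G ⧸ M) ∧ ¬ IsAmenableGroup (G ⧸ M) ∧ IsSimpleGroup (G ⧸ M) := by
  have : Group.FG G := hG.fg
  have hfin (H : Subgroup G) (hH : H.FiniteIndex) : H = ⊤ := hG.eq_top_of_finiteIndex H
  have hcenter := Subgroup.le_center_of_forall_finiteIndex hfin M hfg hrf
  refine ⟨hcenter, ⟨?_, Group.isPerfect_of_forall_finiteIndex hfin⟩, QuotientGroup.fg M,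
    fun ham => hG.not_sofic (HasSoficApproximations.of_le_center M hcenter hrf ham).isSofic,
    hM.isSimpleGroup_quotient⟩
  exact (M.range_subtype).trans_le hcenter
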